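/- Let $(E,d)$ be a metric space with a Borel measure $\mu$, and let $\alpha\in(0,2)$. Write $B(x,r)=\{y:d(x,y)<r\}$, and write $f\asymp g$ on a set if there is $c>0$ with $c^{-1}<f/g<c$ at all points of it. Assume the following. (a) $p_t(x,y)$, $t>0$, is a heat kernel: each $p_t$ is a nonnegative measurable function on $E\times E$; for all $s,t>0$ and $\mu$-almost all $x,y$ we have $p_t(x,y)=p_t(y,x)$, $\int_E p_t(x,y)\,d\mu(y)=1$ and $p_{t+s}(x,y)=\int_E p_t(x,z)p_s(z,y)\,d\mu(z)$; and for each $u\in L^2(E,\mu)$, $\int_E p_t(\cdot,y)u(y)\,d\mu(y)\to u$ in $L^2(E,\mu)$ as $t\to0^+$. (b) $(X_t,P_x)$ is a Markov process on $E$ with right-continuous paths, $P_x[X_0=x]=1$, and $P_x[X_t\in B]=\int_B p_t(x,y)\,d\mu(y)$ for all $x\in E$, $t>0$ and Borel sets $B$. (c) There is a function $V:(0,\infty)\to[0,\infty)$ with $\mu(B(x,r))=V(r)$ for all $x\in E$ and $r>0$. There are $A\ge1$ and $c_1<1$ such that $V(r)\le c_1V(r+A)$ for all $r\ge1$, and $V(r+1)\asymp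 V(r)$ on $r\ge1$. (d) For every $M>0$, $$p_t(x,y)\asymp t\,d(x,y)^{-1-\alpha/2}\,V(d(x,y))^{-1}$$ on the set of all $t>0$ and $x,y\in E$ with $d(x,y)>Mt^{2/\alpha}$ and $d(x,y)>1$. For $D\subset E$ let $\tau_D=\inf\{t\ge0: X_t\notin D\}$, with $\inf\emptyset=\infty$. Then for every $M>0$ there is a constant $c>0$ such that for all $x\in E$, $r>1$ and $t>0$ with $r>Mt^{2/\alpha}$, $$P_x[\tau_{B(x,r)}<t]\le c\,t\,r^{-\alpha/2}.$$ -/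

import Mathlib

open MeasureTheory Set Filter
open scoped NNReal ENNReal Topology

/-- `f ≍ g` on the set `S`: there is `c > 0` such that `c⁻¹ < f / g < c` at all points of `S`. -/
def ComparableOn {ι : Type*} (S : Set ι) (f g : ι → ℝ) : Prop :=
  ∃ c : ℝ, 0 < c ∧ ∀ i ∈ S, c⁻¹ < f i / g i ∧ f i / g i < c

/-- A (stochastically complete) heat kernel on a metric measure space: a family `p t`, `t > 0`, of
nonnegative measurable functions on `E × E` which, almost everywhere, is symmetric, has total mass
one and satisfies the Chapman-Kolmogorov identity, and which is an approximate identity in `L²`.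
Integrals of nonnegative functions are taken in `[0, ∞]`. -/
structure IsHeatKernel {E : Type*} [MeasurableSpace E] (μ : Measure E)
    (p : ℝ≥0 → E → E → ℝ) : Prop where
  measurable : ∀ t, 0 < t → Measurable (fun z : E × E => p t z.1 z.2)
  nonneg : ∀ t, 0 < t → ∀ x y, 0 ≤ p t x y
  symm : ∀ t, 0 < t → ∀ᵐ z ∂(μ.prod μ), p t z.1 z.2 = p t z.2 z.1
  mass_one : ∀ t, 0 < t → ∀ᵐ x ∂μ, ∫⁻ y, ENNReal.ofReal (p t x y) ∂μ = 1
  chapman_kolmogorov : ∀ s t, 0 < s → 0 < t → ∀ᵐ z ∂(μ.prod μ),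
    ENNReal.ofReal (p (t + s) z.1 z.2) =
      ∫⁻ w, ENNReal.ofReal (p t z.1 w) * ENNReal.ofReal (p s w z.2) ∂μ
  approx_identity : ∀ u : E → ℝ, MemLp u 2 μ →
    Tendsto (fun t : ℝ≥0 => eLpNorm (fun x => (∫ y, p t x y * u y ∂μ) - u x) 2 μ)
      (𝓝[>] 0) (𝓝 0)

/-- `(X, P)` is a Markov process with right-continuous paths and transition densities `p` with
respect to `μ`; `P x` is the law of the process started at `x`. The Markov property is the one at
deterministic times, relative to the natural filtration `σ(X u, u ≤ s)`. -/
structure IsMarkovProcessWithKernel {E Ω : Type*} [TopologicalSpace E] [MeasurableSpace E]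
    [MeasurableSpace Ω] (μ : Measure E) (p : ℝ≥0 → E → E → ℝ)
    (P : E → Measure Ω) (X : ℝ≥0 → Ω → E) : Prop where
  isProbabilityMeasure : ∀ x, IsProbabilityMeasure (P x)
  measurable : ∀ t, Measurable (X t)
  start : ∀ x, ∀ᵐ ω ∂(P x), X 0 ω = x
  rightContinuous : ∀ x, ∀ᵐ ω ∂(P x), ∀ t, ContinuousWithinAt (fun s => X s ω) (Ici t) t
  transition : ∀ x t, 0 < t → ∀ B : Set E, MeasurableSet B →
    P x {ω | X t ω ∈ B} = ∫⁻ y in B, ENNReal.ofReal (p t x y) ∂μ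
  markov : ∀ x s t, ∀ B : Set E, MeasurableSet B → ∀ A : Set Ω,
    MeasurableSet[⨆ u : Iic s, MeasurableSpace.comap (X u) inferInstance] A →
      P x (A ∩ {ω | X (s + t) ω ∈ B}) = ∫⁻ ω in A, P (X s ω) {ω' | X t ω' ∈ B} ∂(P x)

/-- The exit time `τ_D = inf {t ≥ 0 : X t ∉ D}`, with `inf ∅ = ∞`. -/
noncomputable def exitTime {E Ω : Type*} (X : ℝ≥0 → Ω → E) (D : Set E) : Ω → WithTop ℝ≥0 :=
  hittingAfter X Dᶜ 0

/-- `V` is the volume growth of a homogeneous space: every ball of radius `r > 0` has measure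
`V r < ∞`. -/
def IsVolumeGrowth {E : Type*} [MetricSpace E] [MeasurableSpace E] (μ : Measure E)
    (V : ℝ → ℝ≥0) : Prop :=
  ∀ x r, 0 < r → μ (Metric.ball x r) = V r

/-- The growth condition on the volume: there are `A ≥ 1` and `c₁ < 1` with
`V r ≤ c₁ V (r + A)` for `r ≥ 1`, and `V (r + 1) ≍ V r` for `r ≥ 1`. -/
def VolumeCondition (V : ℝ → ℝ≥0) : Prop :=
  (∃ A c₁ : ℝ, 1 ≤ A ∧ c₁ < 1 ∧ ∀ r : ℝ, 1 ≤ r → (V r : ℝ) ≤ c₁ * V (r + A)) ∧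
    ComparableOn (Ici (1 : ℝ)) (fun r => (V (r + 1) : ℝ)) (fun r => (V r : ℝ))

/-- The off-diagonal kernel estimate: for each `M > 0`,
`p t x y ≍ t d(x,y)^(-1-α/2) V(d(x,y))⁻¹` over all `t > 0` and all `x, y` with
`d(x,y) > M t^(2/α)` and `d(x,y) > 1`. -/
def StableKernelEstimate {E : Type*} [MetricSpace E] (α : ℝ) (V : ℝ → ℝ≥0)
    (p : ℝ≥0 → E → E → ℝ) : Prop :=
  ∀ M : ℝ, 0 < M →
    ComparableOn
      {z : ℝ≥0 × E × E | 0 < z.1 ∧ M * (z.1 : ℝ) ^ (2 / α) < dist z.2.1 z.2.2 ∧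
        1 < dist z.2.1 z.2.2}
      (fun z => p z.1 z.2.1 z.2.2)
      (fun z => (z.1 : ℝ) * dist z.2.1 z.2.2 ^ (-1 - α / 2) * (V (dist z.2.1 z.2.2) : ℝ)⁻¹)

/-! Summing the kernel bound over unit shells gives P_x[d(X_t,x) ≥ r] ≤ C t r^(-α/2) for r > 1
(`exists_tail_bound`): volumes cancel, since V(r+1) ≤ c V(r). It remains to pass from one time to
all times before t. Right continuity reduces exits to visits at finitely many times, so the Markov
property at deterministic times suffices, applied at the first visit.

For r > 3, Ottaviani's argument applies: a path that gets 2r/3 away from x is, with conditional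
probability at least 1/2, still r/3 away at time t, which the tail bound at r/3 > 1 controls.

For 1 < r ≤ 3 that scale is lost, as nothing is known at distances up to 1. Only small t matters,
and the test function is the density k = p_t(x,·) itself. By symmetry and Chapman-Kolmogorov, the
conditional mean of k(X_t) after a visit to y at time s is p_{2t-s}(x,y), at most U = O(t) when
d(x,y) > 1. By Markov's inequality k(X_t) ≤ 2U at least half the time after a visit. But X_t lies in
a region of density at most 2U inside a fixed ball with probability O(t), and outside that ball by
the tail bound. -/

/-- A finite-ball measure is `σ`-finite. -/
lemma IsVolumeGrowth.sigmaFinite {E : Type*} [MetricSpace E] [MeasurableSpace E] {μ : Measure E}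
    {V : ℝ → ℝ≥0} (hV : IsVolumeGrowth μ V) (x : E) : SigmaFinite μ :=
  ⟨⟨{ set := fun n : ℕ => Metric.ball x (n + 1)
      set_mem := fun _ => trivial
      finite := fun n => by
        rw [hV x _ (by positivity)]
        exact ENNReal.coe_lt_top
      spanning := by
        refine eq_univ_of_forall fun y => mem_iUnion.2 ?_
        obtain ⟨n, hn⟩ := exists_nat_gt (dist y x)
        exact ⟨n, Metric.mem_ball.2 (by linarith)⟩ }⟩⟩

lemma IsVolumeGrowth.mono {E : Type*} [MetricSpace E] [MeasurableSpace E] {μ : Measure E}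
    {V : ℝ → ℝ≥0} (hV : IsVolumeGrowth μ V) (x : E) {r s : ℝ} (hr : 0 < r) (hrs : r ≤ s) :
    V r ≤ V s := by
  have h := measure_mono (μ := μ) (Metric.ball_subset_ball (x := x) hrs)
  rw [hV x r hr, hV x s (hr.trans_le hrs)] at h
  exact_mod_cast h

lemma IsHeatKernel.measurable_ofReal {E : Type*} [MeasurableSpace E] {μ : Measure E}
    {p : ℝ≥0 → E → E → ℝ} (hp : IsHeatKernel μ p) {t : ℝ≥0} (ht : 0 < t) :
    Measurable (fun z : E × E => ENNReal.ofReal (p t z.1 z.2)) :=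
  (hp.measurable t ht).ennreal_ofReal

lemma IsHeatKernel.measurable_ofReal_right {E : Type*} [MeasurableSpace E] {μ : Measure E}
    {p : ℝ≥0 → E → E → ℝ} (hp : IsHeatKernel μ p) {t : ℝ≥0} (ht : 0 < t) (x : E) :
    Measurable (fun y => ENNReal.ofReal (p t x y)) :=
  (hp.measurable_ofReal ht).comp measurable_prodMk_left

/-! ### The Markov property for functions -/

section MarkovProperty

variable {E Ω : Type*} [TopologicalSpace E] [MeasurableSpace E] [MeasurableSpace Ω]
  {μ : Measure E} {p : ℝ≥0 → E → E → ℝ} {P : E → Measure Ω} {X : ℝ≥0 → Ω → E}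

lemma IsMarkovProcessWithKernel.map_eq_withDensity (hX : IsMarkovProcessWithKernel μ p P X)
    (x : E) {t : ℝ≥0} (ht : 0 < t) :
    (P x).map (X t) = μ.withDensity (fun y => ENNReal.ofReal (p t x y)) := by
  ext B hB
  rw [Measure.map_apply (hX.measurable t) hB, withDensity_apply _ hB]
  exact hX.transition x t ht B hB

lemma IsMarkovProcessWithKernel.ae_comp (hX : IsMarkovProcessWithKernel μ p P X)
    (x : E) {t : ℝ≥0} (ht : 0 < t) {Q : E → Prop} (hQ : ∀ᵐ y ∂μ, Q y) :
    ∀ᵐ ω ∂(P x), Q (X t ω) := by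
  refine ae_of_ae_map (hX.measurable t).aemeasurable ?_
  rw [hX.map_eq_withDensity x ht]
  exact (withDensity_absolutelyContinuous _ _) hQ

lemma IsMarkovProcessWithKernel.lintegral_comp (hX : IsMarkovProcessWithKernel μ p P X)
    (hp : IsHeatKernel μ p) (x : E) {t : ℝ≥0} (ht : 0 < t) {f : E → ℝ≥0∞} (hf : Measurable f) :
    ∫⁻ ω, f (X t ω) ∂(P x) = ∫⁻ y, ENNReal.ofReal (p t x y) * f y ∂μ := by
  rw [← lintegral_map hf (hX.measurable t), hX.map_eq_withDensity x ht,
    lintegral_withDensity_eq_lintegral_mul _ (hp.measurable_ofReal_right ht x) hf]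
  rfl

/-- The Markov property at a deterministic time, for nonnegative measurable functions. -/
lemma IsMarkovProcessWithKernel.setLIntegral_comp_add [SFinite μ]
    (hX : IsMarkovProcessWithKernel μ p P X)
    (hp : IsHeatKernel μ p) (x : E) (s : ℝ≥0) {t : ℝ≥0} (ht : 0 < t) {A : Set Ω}
    (hA : MeasurableSet[⨆ u : Iic s, MeasurableSpace.comap (X u) inferInstance] A)
    {f : E → ℝ≥0∞} (hf : Measurable f) :
    ∫⁻ ω in A, f (X (s + t) ω) ∂(P x) =
      ∫⁻ ω in A, ∫⁻ y, ENNReal.ofReal (p t (X s ω) y) * f y ∂μ ∂(P x) := by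
  have hA' : MeasurableSet A := by
    refine (iSup_le fun u : Iic s => ?_ :
      ⨆ u : Iic s, MeasurableSpace.comap (X u) inferInstance ≤ _) A hA
    exact (hX.measurable u).comap_le
  have hmeas : ∀ g : E → ℝ≥0∞, Measurable g →
      Measurable fun z => ∫⁻ y, ENNReal.ofReal (p t z y) * g y ∂μ := fun g hg =>
    Measurable.lintegral_prod_right' (f := fun z : E × E => ENNReal.ofReal (p t z.1 z.2) * g z.2)
      ((hp.measurable_ofReal ht).mul (hg.comp measurable_snd))
  have hcomp : ∀ g : E → ℝ≥0∞, Measurable g → ∀ u, Measurable fun ω => g (X u ω) :=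
    fun g hg u => hg.comp (hX.measurable u)
  have hmeas' : ∀ g : E → ℝ≥0∞, Measurable g →
      Measurable fun ω => ∫⁻ y, ENNReal.ofReal (p t (X s ω) y) * g y ∂μ := fun g hg =>
    (hmeas g hg).comp (hX.measurable s)
  refine Measurable.ennreal_induction (motive := fun f => ∫⁻ ω in A, f (X (s + t) ω) ∂(P x) =
      ∫⁻ ω in A, ∫⁻ y, ENNReal.ofReal (p t (X s ω) y) * f y ∂μ ∂(P x)) ?_ ?_ ?_ hf
  · intro c B hB
    have h1 : ∀ ω, B.indicator (fun _ => c) (X (s + t) ω)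
        = {ω | X (s + t) ω ∈ B}.indicator (fun _ => c) ω := fun ω => rfl
    have hB' : MeasurableSet {ω | X (s + t) ω ∈ B} := hX.measurable _ hB
    have h2 : ∀ (c : ℝ≥0∞) (z : E), ∫⁻ y, ENNReal.ofReal (p t z y) * B.indicator (fun _ => c) y ∂μ
        = c * P z {ω' | X t ω' ∈ B} := by
      intro c z
      rw [hX.transition z t ht B hB, ← lintegral_const_mul _ (hp.measurable_ofReal_right ht z),
        ← lintegral_indicator hB]
      refine lintegral_congr fun y => ?_
      by_cases hy : y ∈ B <;> simp [hy, mul_comm]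
    -- Measurability in the starting point is not part of the Markov process axioms; it comes from
    -- joint measurability of the kernel.
    have h3 : Measurable fun z => P z {ω' | X t ω' ∈ B} := by
      simpa only [h2, one_mul] using hmeas (B.indicator fun _ => 1) (measurable_const.indicator hB)
    simp_rw [h1, h2]
    rw [lintegral_indicator hB', setLIntegral_const, Measure.restrict_apply hB', inter_comm,
      hX.markov x s t B hB A hA, lintegral_const_mul _ (hcomp _ h3 s)]
  · intro f g _ hf hg ihf ihg
    simp only [Pi.add_apply, mul_add]
    rw [lintegral_add_left (hcomp f hf _), ihf, ihg,
      ← lintegral_add_left (hmeas' f hf)]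
    refine lintegral_congr fun ω => ?_
    exact (lintegral_add_left ((hp.measurable_ofReal_right ht _).mul hf) _).symm
  · intro f hf hmono ih
    simp only [ENNReal.mul_iSup]
    rw [lintegral_iSup (fun n => hcomp _ (hf n) _)
      (fun i j hij ω => hmono hij _)]
    have h1 : ∀ ω, ∫⁻ y, ⨆ i, ENNReal.ofReal (p t (X s ω) y) * f i y ∂μ
        = ⨆ i, ∫⁻ y, ENNReal.ofReal (p t (X s ω) y) * f i y ∂μ := fun ω =>
      lintegral_iSup (fun n => (hp.measurable_ofReal_right ht _).mul (hf n))
        (fun i j hij y => mul_le_mul_right (hmono hij y) _)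
    simp_rw [h1]
    rw [lintegral_iSup (fun n => hmeas' _ (hf n))
      (fun i j hij ω => lintegral_mono fun y => mul_le_mul_right (hmono hij y) _)]
    exact iSup_congr ih

end MarkovProperty

/-! ### First visits at finitely many times -/

section FirstEntrance

variable {E Ω : Type*}

/-- The event that, among the times of `F`, the path `X` visits `D` at time `s` and not before. -/
def firstEntrance (X : ℝ≥0 → Ω → E) (F : Finset ℝ≥0) (D : Set E) (s : ℝ≥0) : Set Ω :=
  {ω | X s ω ∈ D ∧ ∀ u ∈ F, u < s → X u ω ∉ D}

lemma biUnion_firstEntrance (X : ℝ≥0 → Ω → E) (F : Finset ℝ≥0) (D : Set E) :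
    ⋃ s ∈ F, firstEntrance X F D s = {ω | ∃ s ∈ F, X s ω ∈ D} := by
  classical
  ext ω
  simp only [mem_iUnion, exists_prop, mem_ofPred_eq]
  constructor
  · rintro ⟨s, hs, h⟩
    exact ⟨s, hs, h.1⟩
  · rintro ⟨s, hs, h⟩
    have hne : (F.filter fun u => X u ω ∈ D).Nonempty := ⟨s, by simp [hs, h]⟩
    obtain ⟨hm₁, hm₂⟩ := Finset.mem_filter.1 (Finset.min'_mem _ hne)
    refine ⟨_, hm₁, hm₂, fun u hu hlt hmem => ?_⟩
    exact absurd hlt (not_lt.2 (Finset.min'_le _ _ (by simp [hu, hmem])))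

lemma pairwiseDisjoint_firstEntrance (X : ℝ≥0 → Ω → E) (F : Finset ℝ≥0) (D : Set E) :
    (F : Set ℝ≥0).PairwiseDisjoint (firstEntrance X F D) := by
  intro s hs u hu hne
  refine Set.disjoint_left.2 fun ω h₁ h₂ => ?_
  rcases lt_or_gt_of_ne hne with h | h
  · exact h₂.2 s hs h h₁.1
  · exact h₁.2 u hu h h₂.1

/-- Only times up to `s` enter the event, so it belongs to the past σ-algebra required by the Markov
property. -/
lemma measurableSet_firstEntrance [MeasurableSpace E] (X : ℝ≥0 → Ω → E) (F : Finset ℝ≥0)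
    {D : Set E} (hD : MeasurableSet D) (s : ℝ≥0) :
    MeasurableSet[⨆ u : Iic s, MeasurableSpace.comap (X u) inferInstance]
      (firstEntrance X F D s) := by
  have key : ∀ u ≤ s, MeasurableSet[⨆ u : Iic s, MeasurableSpace.comap (X u) inferInstance]
      {ω | X u ω ∈ D} := fun u hu =>
    le_iSup (fun u : Iic s => MeasurableSpace.comap (X u) inferInstance) ⟨u, hu⟩ _ ⟨D, hD, rfl⟩
  have h : firstEntrance X F D s =
      {ω | X s ω ∈ D} ∩ ⋂ u ∈ F.filter (· < s), {ω | X u ω ∈ D}ᶜ := by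
    ext ω
    simp [firstEntrance]
  rw [h]
  refine (key s le_rfl).inter (Finset.measurableSet_biInter _ fun u hu => ?_)
  exact (key u (Finset.mem_filter.1 hu).2.le).compl

variable [TopologicalSpace E] [MeasurableSpace E] [MeasurableSpace Ω]
  {μ : Measure E} {p : ℝ≥0 → E → E → ℝ} {P : E → Measure Ω} {X : ℝ≥0 → Ω → E}

lemma IsMarkovProcessWithKernel.measurableSet_firstEntrance
    (hX : IsMarkovProcessWithKernel μ p P X) (F : Finset ℝ≥0)
    {D : Set E} (hD : MeasurableSet D) (s : ℝ≥0) : MeasurableSet (firstEntrance X F D s) :=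
  (iSup_le fun u : Iic s => (hX.measurable u).comap_le :
    ⨆ u : Iic s, MeasurableSpace.comap (X u) inferInstance ≤ _) _
    (_root_.measurableSet_firstEntrance X F hD s)

lemma IsMarkovProcessWithKernel.measurableSet_entrance
    (hX : IsMarkovProcessWithKernel μ p P X) (F : Finset ℝ≥0)
    {D : Set E} (hD : MeasurableSet D) : MeasurableSet {ω | ∃ s ∈ F, X s ω ∈ D} := by
  rw [← biUnion_firstEntrance]
  exact Finset.measurableSet_biUnion _ fun s _ => hX.measurableSet_firstEntrance F hD s

lemma IsMarkovProcessWithKernel.measure_entrance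
    (hX : IsMarkovProcessWithKernel μ p P X) (x : E) (F : Finset ℝ≥0)
    {D : Set E} (hD : MeasurableSet D) :
    P x {ω | ∃ s ∈ F, X s ω ∈ D} = ∑ s ∈ F, P x (firstEntrance X F D s) := by
  rw [← biUnion_firstEntrance, measure_biUnion_finset (pairwiseDisjoint_firstEntrance X F D)
    fun s _ => hX.measurableSet_firstEntrance F hD s]

/-- Decomposition of an integral at time `t` over the event that `D` was visited at some time of
`F`, according to the first such time. -/
lemma IsMarkovProcessWithKernel.setLIntegral_entrance [SFinite μ]
    (hX : IsMarkovProcessWithKernel μ p P X) (hp : IsHeatKernel μ p) (x : E) {t : ℝ≥0}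
    {F : Finset ℝ≥0} (hF : ∀ s ∈ F, s < t) {D : Set E} (hD : MeasurableSet D)
    {f : E → ℝ≥0∞} (hf : Measurable f) :
    ∫⁻ ω in {ω | ∃ s ∈ F, X s ω ∈ D}, f (X t ω) ∂(P x) =
      ∑ s ∈ F, ∫⁻ ω in firstEntrance X F D s,
        ∫⁻ y, ENNReal.ofReal (p (t - s) (X s ω) y) * f y ∂μ ∂(P x) := by
  rw [← biUnion_firstEntrance, lintegral_biUnion_finset (pairwiseDisjoint_firstEntrance X F D)
    fun s _ => hX.measurableSet_firstEntrance F hD s]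
  refine Finset.sum_congr rfl fun s hs => ?_
  have h := hX.setLIntegral_comp_add hp x s (tsub_pos_of_lt (hF s hs))
    (_root_.measurableSet_firstEntrance X F hD s) hf
  rwa [add_tsub_cancel_of_le (hF s hs).le] at h

lemma IsMarkovProcessWithKernel.mul_measure_entrance_le [SFinite μ]
    (hX : IsMarkovProcessWithKernel μ p P X) (hp : IsHeatKernel μ p) (x : E) {t : ℝ≥0}
    {F : Finset ℝ≥0} (hF : ∀ s ∈ F, s < t) {D : Set E} (hD : MeasurableSet D)
    {f : E → ℝ≥0∞} (hf : Measurable f) {L : ℝ≥0∞}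
    (hL : ∀ s ∈ F, ∀ y ∈ D, L ≤ ∫⁻ z, ENNReal.ofReal (p (t - s) y z) * f z ∂μ) :
    L * P x {ω | ∃ s ∈ F, X s ω ∈ D} ≤
      ∫⁻ ω in {ω | ∃ s ∈ F, X s ω ∈ D}, f (X t ω) ∂(P x) := by
  rw [hX.setLIntegral_entrance hp x hF hD hf, hX.measure_entrance x F hD, Finset.mul_sum]
  refine Finset.sum_le_sum fun s hs => ?_
  rw [← setLIntegral_const]
  exact setLIntegral_mono' (hX.measurableSet_firstEntrance F hD s) fun ω hω => hL s hs _ hω.1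

/-- At a positive time the law of X_s has a density, so a bound for almost every y suffices; this is
why time 0 is excluded from `F`. -/
lemma IsMarkovProcessWithKernel.setLIntegral_entrance_le [SFinite μ]
    (hX : IsMarkovProcessWithKernel μ p P X) (hp : IsHeatKernel μ p) (x : E) {t : ℝ≥0}
    {F : Finset ℝ≥0} (hF₀ : ∀ s ∈ F, 0 < s) (hF : ∀ s ∈ F, s < t) {D : Set E}
    (hD : MeasurableSet D) {f : E → ℝ≥0∞} (hf : Measurable f) {U : ℝ≥0∞}
    (hU : ∀ s ∈ F, ∀ᵐ y ∂μ, y ∈ D → ∫⁻ z, ENNReal.ofReal (p (t - s) y z) * f z ∂μ ≤ U) :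
    ∫⁻ ω in {ω | ∃ s ∈ F, X s ω ∈ D}, f (X t ω) ∂(P x) ≤
      U * P x {ω | ∃ s ∈ F, X s ω ∈ D} := by
  rw [hX.setLIntegral_entrance hp x hF hD hf, hX.measure_entrance x F hD, Finset.mul_sum]
  refine Finset.sum_le_sum fun s hs => ?_
  rw [← setLIntegral_const]
  refine setLIntegral_mono_ae' (hX.measurableSet_firstEntrance F hD s) ?_
  filter_upwards [hX.ae_comp x (hF₀ s hs) (hU s hs)] with ω h hω using h hω.1

/-- Chapman-Kolmogorov in the form `∫ p_s(y,z) p_t(x,z) dμ(z) = p_{t+s}(x,y)`, for every `x` and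
almost every `y`. -/
lemma IsMarkovProcessWithKernel.ae_lintegral_mul_eq [SigmaFinite μ]
    (hX : IsMarkovProcessWithKernel μ p P X) (hp : IsHeatKernel μ p) (x : E) {s t : ℝ≥0}
    (hs : 0 < s) (ht : 0 < t) :
    ∀ᵐ y ∂μ, ∫⁻ z, ENNReal.ofReal (p s y z) * ENNReal.ofReal (p t x z) ∂μ =
      ENNReal.ofReal (p (t + s) x y) := by
  have := hX.isProbabilityMeasure x
  have hmeas : Measurable (fun w : E × E =>
      ENNReal.ofReal (p t x w.2) * ENNReal.ofReal (p s w.2 w.1)) :=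
    ((hp.measurable_ofReal_right ht x).comp measurable_snd).mul
      ((hp.measurable_ofReal hs).comp measurable_swap)
  have h₁ : (fun y => ∫⁻ z, ENNReal.ofReal (p t x z) * ENNReal.ofReal (p s z y) ∂μ) =ᵐ[μ]
      fun y => ENNReal.ofReal (p (t + s) x y) := by
    -- Over any set B both functions integrate to P_x[X_{t+s} ∈ B]. Going through the process gives
    -- the identity for every x, where the heat kernel axiom gives only almost every pair.
    refine ae_eq_of_forall_setLIntegral_eq_of_sigmaFinite hmeas.lintegral_prod_right'
      (hp.measurable_ofReal_right (add_pos ht hs) x) fun B hB _ => ?_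
    have hind : Measurable (B.indicator fun _ => (1 : ℝ≥0∞)) := measurable_const.indicator hB
    rw [← hX.transition x (t + s) (add_pos ht hs) B hB,
      lintegral_lintegral_swap (f := fun y z => ENNReal.ofReal (p t x z) * ENNReal.ofReal (p s z y))
        hmeas.aemeasurable]
    have h := hX.markov x t s B hB univ MeasurableSet.univ
    rw [univ_inter, setLIntegral_univ] at h
    have hPm : Measurable fun z => P z {ω | X s ω ∈ B} := by
      have : (fun z => P z {ω | X s ω ∈ B}) = fun z => ∫⁻ y in B, ENNReal.ofReal (p s z y) ∂μ :=
        funext fun z => hX.transition z s hs B hB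
      rw [this]
      exact (hp.measurable_ofReal hs).lintegral_prod_right'
    rw [h, hX.lintegral_comp hp x ht hPm]
    refine lintegral_congr fun z => ?_
    rw [hX.transition z s hs B hB, lintegral_const_mul _ (hp.measurable_ofReal_right hs z)]
  filter_upwards [Measure.ae_ae_of_ae_prod (hp.symm s hs), h₁] with y hy h
  rw [← h]
  refine lintegral_congr_ae ?_
  filter_upwards [hy] with z hz
  rw [mul_comm, show p s y z = p s z y from hz]

end FirstEntrance

/-! ### From exit times to finite sets of times -/

/-- By right continuity, a path leaving the open ball of radius `r` before time `t` is outside a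
strictly smaller ball at one of the times of a given dense sequence, before `t`. -/
lemma exists_dense_of_exitTime_lt {E Ω : Type*} [MetricSpace E] {X : ℝ≥0 → Ω → E} {ω : Ω}
    (hω : ∀ t, ContinuousWithinAt (fun s => X s ω) (Ici t) t) {x : E} {r r' : ℝ} (hr : r' < r)
    {t : ℝ≥0} (ht : exitTime X (Metric.ball x r) ω < (t : WithTop ℝ≥0)) {u : ℕ → ℝ≥0}
    (hu : DenseRange u) :
    ∃ n, 0 < u n ∧ u n < t ∧ X (u n) ω ∈ (Metric.ball x r')ᶜ := by
  obtain ⟨s, hst, hs⟩ : ∃ s < t, X s ω ∈ (Metric.ball x r)ᶜ := by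
    unfold exitTime hittingAfter at ht
    split_ifs at ht with h
    · obtain ⟨j, hj⟩ := h
      obtain ⟨s, hs, hlt⟩ := exists_lt_of_csInf_lt ⟨j, hj⟩ (WithTop.coe_lt_coe.1 ht)
      exact ⟨s, hlt, hs.2⟩
    · exact absurd ht not_top_lt
  have hs' : r' < dist (X s ω) x := hr.trans_le (by simpa using hs)
  have hev : ∀ᶠ v in 𝓝[≥] s, r' < dist (X v ω) x :=
    ((hω s).dist continuousWithinAt_const).eventually (lt_mem_nhds hs')
  obtain ⟨v, hsv, hv⟩ := (mem_nhdsGE_iff_exists_Ico_subset' hst).1 hev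
  obtain ⟨w, hw, n, rfl⟩ := hu.inter_open_nonempty (Ioo s (min v t)) isOpen_Ioo
    (nonempty_Ioo.2 (lt_min hsv hst))
  refine ⟨n, (zero_le).trans_lt hw.1, hw.2.trans_le (min_le_right _ _), ?_⟩
  have := hv ⟨hw.1.le, hw.2.trans_le (min_le_left _ _)⟩
  simpa using le_of_lt this

/-- A bound for the visits of finite sets of times to the complement of a smaller ball bounds the
probability of exit. -/
lemma IsMarkovProcessWithKernel.measure_exitTime_lt_le {E Ω : Type*} [MetricSpace E]
    [MeasurableSpace E] [MeasurableSpace Ω] {μ : Measure E} {p : ℝ≥0 → E → E → ℝ}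
    {P : E → Measure Ω} {X : ℝ≥0 → Ω → E} (hX : IsMarkovProcessWithKernel μ p P X)
    {x : E} {r r' : ℝ} (hr : r' < r) {t : ℝ≥0} {K : ℝ≥0∞}
    (hK : ∀ F : Finset ℝ≥0, (∀ s ∈ F, 0 < s) → (∀ s ∈ F, s < t) →
      P x {ω | ∃ s ∈ F, X s ω ∈ (Metric.ball x r')ᶜ} ≤ K) :
    P x {ω | exitTime X (Metric.ball x r) ω < (t : WithTop ℝ≥0)} ≤ K := by
  classical
  set u := TopologicalSpace.denseSeq ℝ≥0
  let F : ℕ → Finset ℝ≥0 := fun n => ((Finset.range n).image u).filter fun s => 0 < s ∧ s < t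
  let H : ℕ → Set Ω := fun n => {ω | ∃ s ∈ F n, X s ω ∈ (Metric.ball x r')ᶜ}
  have hF : Monotone F := fun m n h =>
    Finset.filter_subset_filter _ (Finset.image_subset_image (Finset.range_mono h))
  have hH : Monotone H := fun m n h ω ⟨s, hs, hsω⟩ => ⟨s, hF h hs, hsω⟩
  calc P x {ω | exitTime X (Metric.ball x r) ω < (t : WithTop ℝ≥0)}
      ≤ P x (⋃ n, H n) := by
        refine measure_mono_ae ?_
        filter_upwards [hX.rightContinuous x] with ω hω ht
        obtain ⟨n, h₀, h₁, h₂⟩ :=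
          exists_dense_of_exitTime_lt hω hr ht (TopologicalSpace.denseRange_denseSeq ℝ≥0)
        exact mem_iUnion.2 ⟨n + 1, u n, Finset.mem_filter.2
          ⟨Finset.mem_image_of_mem u (Finset.mem_range.2 n.lt_succ_self), h₀, h₁⟩, h₂⟩
    _ = ⨆ n, P x (H n) := hH.measure_iUnion
    _ ≤ K := iSup_le fun n => hK _ (fun s hs => (Finset.mem_filter.1 hs).2.1)
        fun s hs => (Finset.mem_filter.1 hs).2.2

/-! ### Power sums and volume bounds -/

/-- A telescoping bound for the shell sum: convexity of x^(-b) bounds the difference below by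
b(x+1)^(-1-b), and x + 1 ≤ 2x costs the factor 2^(1+b). -/
lemma rpow_neg_one_sub_le_mul_sub {b : ℝ} (hb : 0 < b) {x : ℝ} (hx : 1 ≤ x) :
    x ^ (-1 - b) ≤ 2 ^ (1 + b) / b * (x ^ (-b) - (x + 1) ^ (-b)) := by
  have hx₀ : 0 < x := by linarith
  have hu : 0 < x + 1 := by linarith
  have h₁ : b * (x + 1) ^ (-1 - b) ≤ x ^ (-b) - (x + 1) ^ (-b) := by
    have hlog : Real.log (x / (x + 1)) ≤ -(1 / (x + 1)) := by
      have := Real.log_le_sub_one_of_pos (div_pos hx₀ hu)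
      have e : x / (x + 1) - 1 = -(1 / (x + 1)) := by field_simp; ring
      linarith
    have hexp : 1 + b * (1 / (x + 1)) ≤ (x / (x + 1)) ^ (-b) := by
      rw [Real.rpow_def_of_pos (div_pos hx₀ hu)]
      have := Real.add_one_le_exp (Real.log (x / (x + 1)) * -b)
      nlinarith
    rw [Real.div_rpow hx₀.le hu.le, le_div_iff₀ (Real.rpow_pos_of_pos hu _)] at hexp
    have e : (x + 1) ^ (-1 - b) = 1 / (x + 1) * (x + 1) ^ (-b) := by
      rw [sub_eq_add_neg, Real.rpow_add hu, Real.rpow_neg_one, one_div]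
    rw [e]
    linarith
  have h₂ : x ^ (-1 - b) ≤ 2 ^ (1 + b) * (x + 1) ^ (-1 - b) := by
    have h : (2 * x) ^ (-1 - b) ≤ (x + 1) ^ (-1 - b) :=
      Real.rpow_le_rpow_of_nonpos hu (by linarith) (by linarith)
    rw [Real.mul_rpow (by norm_num) hx₀.le] at h
    have e : (2 : ℝ) ^ (1 + b) * 2 ^ (-1 - b) = 1 := by
      rw [← Real.rpow_add (by norm_num)]; norm_num
    calc x ^ (-1 - b) = 2 ^ (1 + b) * (2 ^ (-1 - b) * x ^ (-1 - b)) := by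
          rw [← mul_assoc, e, one_mul]
      _ ≤ _ := by gcongr
  calc x ^ (-1 - b) ≤ 2 ^ (1 + b) / b * (b * (x + 1) ^ (-1 - b)) := by
        rw [div_mul_eq_mul_div, ← mul_assoc, mul_right_comm, mul_div_cancel_right₀ _ hb.ne']
        exact h₂
    _ ≤ _ := by gcongr

lemma tsum_ofReal_rpow_neg_one_sub_le {b : ℝ} (hb : 0 < b) {r : ℝ} (hr : 1 ≤ r) {K : ℝ}
    (hK : 0 ≤ K) :
    ∑' n : ℕ, ENNReal.ofReal (K * (r + n) ^ (-1 - b)) ≤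
      ENNReal.ofReal (K * (2 ^ (1 + b) / b) * r ^ (-b)) := by
  refine ENNReal.tsum_le_of_sum_range_le fun N => ?_
  rw [← ENNReal.ofReal_sum_of_nonneg fun n _ => by positivity]
  refine ENNReal.ofReal_le_ofReal ?_
  calc ∑ n ∈ Finset.range N, K * (r + n) ^ (-1 - b)
      ≤ ∑ n ∈ Finset.range N,
          K * (2 ^ (1 + b) / b) * ((r + n) ^ (-b) - (r + (n + 1 : ℕ)) ^ (-b)) := by
        refine Finset.sum_le_sum fun n _ => ?_
        rw [mul_assoc]
        have := rpow_neg_one_sub_le_mul_sub hb (x := r + n) (by linarith [n.cast_nonneg (α := ℝ)])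
        push_cast
        rw [← add_assoc]
        gcongr
    _ = K * (2 ^ (1 + b) / b) * (r ^ (-b) - (r + N) ^ (-b)) := by
        rw [← Finset.mul_sum, Finset.sum_range_sub' fun n : ℕ => (r + n : ℝ) ^ (-b)]
        simp
    _ ≤ _ := by
        have : 0 ≤ (r + N : ℝ) ^ (-b) := by positivity
        gcongr
        linarith

/-- If V r were 0, the quotient would be 0 by the convention for division, contradicting its
positive lower bound. -/
lemma VolumeCondition.pos {V : ℝ → ℝ≥0} (h : VolumeCondition V) {r : ℝ} (hr : 1 ≤ r) : 0 < V r := by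
  obtain ⟨-, c, hc, h⟩ := h
  refine pos_iff_ne_zero.2 fun h₀ => ?_
  have : c⁻¹ < (V (r + 1) : ℝ) / V r := (h r hr).1
  rw [h₀, NNReal.coe_zero, div_zero] at this
  exact absurd this (inv_pos.2 hc).not_gt

lemma VolumeCondition.exists_le_mul {V : ℝ → ℝ≥0} (h : VolumeCondition V) :
    ∃ c : ℝ, 0 < c ∧ ∀ r, 1 ≤ r → (V (r + 1) : ℝ) ≤ c * V r := by
  obtain ⟨c, hc, h'⟩ := h.2
  exact ⟨c, hc, fun r hr => ((div_lt_iff₀ (by exact_mod_cast h.pos hr)).1 (h' r hr).2).le⟩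

lemma StableKernelEstimate.exists_upper_bound {E : Type*} [MetricSpace E] {α : ℝ}
    {V : ℝ → ℝ≥0} {p : ℝ≥0 → E → E → ℝ} (hest : StableKernelEstimate α V p)
    (hvol : VolumeCondition V) :
    ∃ C : ℝ, 0 < C ∧ ∀ (t : ℝ≥0) (x y : E), 0 < t → (t : ℝ) ^ (2 / α) < dist x y →
      1 < dist x y →
      p t x y ≤ C * (t * dist x y ^ (-1 - α / 2) * (V (dist x y) : ℝ)⁻¹) := by
  obtain ⟨C, hC, h⟩ := hest 1 one_pos
  refine ⟨C, hC, fun t x y ht htd hd => ?_⟩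
  have hV : (0 : ℝ) < V (dist x y) := by exact_mod_cast hvol.pos hd.le
  have ht' : (0 : ℝ) < t := by exact_mod_cast ht
  have hd₀ : 0 < dist x y := by linarith
  exact ((div_lt_iff₀ (by positivity)).1 (h (t, x, y) ⟨ht, by simpa using htd, hd⟩).2).le

lemma exists_shell {E : Type*} [MetricSpace E] {x y : E} {r : ℝ} (h : r ≤ dist y x) :
    ∃ n : ℕ, y ∈ Metric.ball x (r + n + 1) \ Metric.ball x (r + n) := by
  refine ⟨⌊dist y x - r⌋₊, ?_, ?_⟩
  · have := Nat.lt_floor_add_one (dist y x - r)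
    rw [Metric.mem_ball]
    linarith
  · have := Nat.floor_le (sub_nonneg.2 h)
    rw [Metric.mem_ball, not_lt]
    linarith

/-! ### Tail bound and the two maximal inequalities -/

section Estimates

variable {E Ω : Type*} [MetricSpace E] [MeasurableSpace E] [MeasurableSpace Ω]
  {μ : Measure E} {α : ℝ} {p : ℝ≥0 → E → E → ℝ} {P : E → Measure Ω} {X : ℝ≥0 → Ω → E}
  {V : ℝ → ℝ≥0}

/-- The one-time tail bound `P_x[d(X_t,x) ≥ r] ≤ C t r^(-α/2)`. -/
lemma IsMarkovProcessWithKernel.exists_tail_bound [OpensMeasurableSpace E]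
    (hX : IsMarkovProcessWithKernel μ p P X) (hα : 0 < α) (hV : IsVolumeGrowth μ V)
    (hvol : VolumeCondition V) (hest : StableKernelEstimate α V p) :
    ∃ C : ℝ, 0 < C ∧ ∀ (x : E) (r : ℝ) (t : ℝ≥0), 1 < r → 0 < t →
      P x {ω | X t ω ∈ (Metric.ball x r)ᶜ} ≤ ENNReal.ofReal (C * t * r ^ (-(α / 2))) := by
  obtain ⟨C, hC, hCp⟩ := hest.exists_upper_bound hvol
  obtain ⟨c, hc, hcV⟩ := hvol.exists_le_mul
  have hb : 0 < α / 2 := by positivity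
  refine ⟨max 1 (C * c * (2 ^ (1 + α / 2) / (α / 2))), by positivity, fun x r t hr ht => ?_⟩
  have := hX.isProbabilityMeasure x
  have hr₀ : 0 < r := by linarith
  have ht' : (0 : ℝ) < t := by exact_mod_cast ht
  -- Below the scale t^(2/α) one has t r^(-α/2) ≥ 1, so a constant at least 1 makes the bound
  -- trivial.
  rcases le_or_gt r ((t : ℝ) ^ (2 / α)) with hrt | hrt
  · refine prob_le_one.trans ?_
    rw [ENNReal.one_le_ofReal]
    have h : r ^ (α / 2) ≤ t := by
      calc r ^ (α / 2) ≤ ((t : ℝ) ^ (2 / α)) ^ (α / 2) :=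
            Real.rpow_le_rpow hr₀.le hrt hb.le
        _ = t := by
            rw [← Real.rpow_mul ht'.le, div_mul_div_comm, mul_comm, div_self (by positivity),
              Real.rpow_one]
    calc (1 : ℝ) = 1 * r ^ (α / 2) * r ^ (-(α / 2)) := by
          rw [one_mul, ← Real.rpow_add hr₀, add_neg_cancel, Real.rpow_zero]
      _ ≤ _ := by
          gcongr
          exact le_max_left _ _
  · have hshell : ∀ n : ℕ, ∫⁻ y in Metric.ball x (r + n + 1) \ Metric.ball x (r + n),
        ENNReal.ofReal (p t x y) ∂μ ≤ ENNReal.ofReal (C * c * t * (r + n) ^ (-1 - α / 2)) := by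
      intro n
      have hn : (0 : ℝ) ≤ n := n.cast_nonneg
      have hVn : (0 : ℝ) < V (r + n) := by exact_mod_cast hvol.pos (by linarith)
      calc ∫⁻ y in Metric.ball x (r + n + 1) \ Metric.ball x (r + n), ENNReal.ofReal (p t x y) ∂μ
          ≤ ∫⁻ _ in Metric.ball x (r + n + 1) \ Metric.ball x (r + n),
              ENNReal.ofReal (C * (t * (r + n) ^ (-1 - α / 2) * (V (r + n) : ℝ)⁻¹)) ∂μ := by
            refine setLIntegral_mono' (measurableSet_ball.diff measurableSet_ball) fun y hy => ?_
            refine ENNReal.ofReal_le_ofReal ?_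
            have hd : r + n ≤ dist x y := by
              rw [dist_comm]; simpa using hy.2
            refine (hCp t x y ht (by linarith) (by linarith)).trans ?_
            have hVd : V (r + n) ≤ V (dist x y) := hV.mono x (by linarith) hd
            have h₁ : dist x y ^ (-1 - α / 2) ≤ (r + n) ^ (-1 - α / 2) :=
              Real.rpow_le_rpow_of_nonpos (by linarith) hd (by linarith)
            gcongr
        _ ≤ ENNReal.ofReal (C * (t * (r + n) ^ (-1 - α / 2) * (V (r + n) : ℝ)⁻¹)) *
              ENNReal.ofReal (V (r + n + 1)) := by
            rw [setLIntegral_const, ENNReal.ofReal_coe_nnreal, ← hV x (r + n + 1) (by linarith)]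
            gcongr
            exact sdiff_subset
        _ ≤ _ := by
            rw [← ENNReal.ofReal_mul (by positivity)]
            refine ENNReal.ofReal_le_ofReal ?_
            calc C * (t * (r + n) ^ (-1 - α / 2) * (V (r + n) : ℝ)⁻¹) * V (r + n + 1)
                ≤ C * (t * (r + n) ^ (-1 - α / 2) * (V (r + n) : ℝ)⁻¹) * (c * V (r + n)) := by
                  gcongr
                  exact hcV _ (by linarith)
              _ = _ := by field_simp
    rw [hX.transition x t ht _ measurableSet_ball.compl]
    calc ∫⁻ y in (Metric.ball x r)ᶜ, ENNReal.ofReal (p t x y) ∂μ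
        ≤ ∫⁻ y in ⋃ n : ℕ, Metric.ball x (r + n + 1) \ Metric.ball x (r + n),
            ENNReal.ofReal (p t x y) ∂μ :=
          lintegral_mono_set fun y hy => mem_iUnion.2 (exists_shell (by simpa using hy))
      _ ≤ ∑' n : ℕ, ENNReal.ofReal (C * c * t * (r + n) ^ (-1 - α / 2)) :=
          (lintegral_iUnion_le _ _).trans (ENNReal.tsum_le_tsum hshell)
      _ ≤ ENNReal.ofReal (C * c * t * (2 ^ (1 + α / 2) / (α / 2)) * r ^ (-(α / 2))) :=
          tsum_ofReal_rpow_neg_one_sub_le hb hr.le (by positivity)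
      _ ≤ _ := by
          refine ENNReal.ofReal_le_ofReal ?_
          rw [mul_right_comm (C * c)]
          gcongr
          exact le_max_right _ _

/-- An Ottaviani-type maximal inequality. -/
lemma IsMarkovProcessWithKernel.measure_entrance_compl_ball_le [OpensMeasurableSpace E] [SFinite μ]
    (hX : IsMarkovProcessWithKernel μ p P X) (hp : IsHeatKernel μ p) (x : E) {a : ℝ} {t : ℝ≥0}
    (ht : 0 < t) {e : ℝ≥0∞}
    (htail : ∀ (y : E) (s : ℝ≥0), 0 < s → s ≤ t → P y {ω | X s ω ∈ (Metric.ball y a)ᶜ} ≤ e)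
    {F : Finset ℝ≥0} (hF : ∀ s ∈ F, s < t) :
    P x {ω | ∃ s ∈ F, X s ω ∈ (Metric.ball x (2 * a))ᶜ} ≤ 2 * e := by
  have hprob := hX.isProbabilityMeasure
  rcases le_or_gt e 2⁻¹ with he | he
  · set H := {ω | ∃ s ∈ F, X s ω ∈ (Metric.ball x (2 * a))ᶜ}
    have hB : MeasurableSet (Metric.ball x a)ᶜ := measurableSet_ball.compl
    have hind : ∀ y s, 0 < s → ∫⁻ z, ENNReal.ofReal (p s y z) *
        (Metric.ball x a)ᶜ.indicator (fun _ => 1) z ∂μ = P y {ω | X s ω ∈ (Metric.ball x a)ᶜ} := by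
      intro y s hs
      rw [← hX.lintegral_comp hp y hs (measurable_const.indicator hB)]
      exact lintegral_indicator_one (hX.measurable s hB)
    have key : 2⁻¹ * P x H ≤ e := by
      calc 2⁻¹ * P x H
          ≤ ∫⁻ ω in H, (Metric.ball x a)ᶜ.indicator (fun _ => 1) (X t ω) ∂(P x) := by
            refine hX.mul_measure_entrance_le hp x hF measurableSet_ball.compl
              (measurable_const.indicator hB) fun s hs y hy => ?_
            -- From y at distance at least 2a from x, entering the ball of radius a about x requires
            -- moving at least a away from y, which has probability at most e ≤ 1/2.
            rw [hind y _ (tsub_pos_of_lt (hF s hs))]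
            have h₁ := htail y (t - s) (tsub_pos_of_lt (hF s hs)) tsub_le_self
            have hm : MeasurableSet {ω | X (t - s) ω ∈ (Metric.ball y a)ᶜ} :=
              hX.measurable _ measurableSet_ball.compl
            have h₂ : 2⁻¹ ≤ P y {ω | X (t - s) ω ∈ (Metric.ball y a)ᶜ}ᶜ := by
              rw [prob_compl_eq_one_sub hm, ← ENNReal.one_sub_inv_two]
              exact tsub_le_tsub_left (h₁.trans he) _
            refine h₂.trans (measure_mono fun ω hω => ?_)
            have hω' : dist (X (t - s) ω) y < a := by simpa using hω
            have hy' : 2 * a ≤ dist y x := by simpa using hy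
            have := dist_triangle_left y x (X (t - s) ω)
            have : a ≤ dist (X (t - s) ω) x := by linarith
            simpa using this
        _ ≤ ∫⁻ ω, (Metric.ball x a)ᶜ.indicator (fun _ => 1) (X t ω) ∂(P x) :=
            setLIntegral_le_lintegral _ _
        _ = P x {ω | X t ω ∈ (Metric.ball x a)ᶜ} :=
            lintegral_indicator_one (hX.measurable t hB)
        _ ≤ e := htail x t ht le_rfl
    calc P x H = 2 * (2⁻¹ * P x H) := by
          rw [← mul_assoc, ENNReal.mul_inv_cancel (by simp) (by simp), one_mul]
      _ ≤ 2 * e := by gcongr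
  · refine prob_le_one.trans ?_
    calc (1 : ℝ≥0∞) = 2 * 2⁻¹ := (ENNReal.mul_inv_cancel (by simp) (by simp)).symm
      _ ≤ 2 * e := by gcongr

/-- If `p_s(x,y) ≤ U` off the ball of radius `b`, for `s` between `t` and `2t`, then the probability
of visiting the complement of this ball before time `t` is controlled by the tail at time `t`. This
uses the symmetry of the kernel and no estimate at small distances. -/
lemma IsMarkovProcessWithKernel.measure_entrance_compl_ball_le_of_kernel_le
    [OpensMeasurableSpace E] [SigmaFinite μ]
    (hX : IsMarkovProcessWithKernel μ p P X) (hp : IsHeatKernel μ p) (x : E) {b R : ℝ} {t : ℝ≥0}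
    (ht : 0 < t) {U : ℝ≥0∞} (hU₀ : U ≠ 0) (hU : U ≠ ∞)
    (hker : ∀ (y : E) (s : ℝ≥0), 0 < s → s ≤ 2 * t → b ≤ dist y x → ENNReal.ofReal (p s x y) ≤ U)
    {F : Finset ℝ≥0} (hF₀ : ∀ s ∈ F, 0 < s) (hF : ∀ s ∈ F, s < t) :
    P x {ω | ∃ s ∈ F, X s ω ∈ (Metric.ball x b)ᶜ} ≤
      2 * (P x {ω | X t ω ∈ (Metric.ball x R)ᶜ} + 2 * U * μ (Metric.ball x R)) := by
  have hprob := hX.isProbabilityMeasure x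
  set H := {ω | ∃ s ∈ F, X s ω ∈ (Metric.ball x b)ᶜ}
  set k : E → ℝ≥0∞ := fun y => ENNReal.ofReal (p t x y)
  have hk : Measurable k := hp.measurable_ofReal_right ht x
  have hlow : P x {ω | X t ω ∈ Metric.ball x R ∩ {y | k y ≤ 2 * U}} ≤
      2 * U * μ (Metric.ball x R) := by
    have hm : MeasurableSet (Metric.ball x R ∩ {y | k y ≤ 2 * U}) :=
      measurableSet_ball.inter (measurableSet_le hk measurable_const)
    rw [hX.transition x t ht _ hm]
    calc ∫⁻ y in Metric.ball x R ∩ {y | k y ≤ 2 * U}, k y ∂μ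
        ≤ ∫⁻ _ in Metric.ball x R ∩ {y | k y ≤ 2 * U}, 2 * U ∂μ :=
          setLIntegral_mono' hm fun y hy => hy.2
      _ ≤ 2 * U * μ (Metric.ball x R) := by
          rw [setLIntegral_const]
          gcongr
          exact inter_subset_left
  -- The integral after a visit at (s, y) is p_{2t-s}(x,y), and 2t - s is a time at most 2t.
  have hint : ∫⁻ ω in H, k (X t ω) ∂(P x) ≤ U * P x H := by
    refine hX.setLIntegral_entrance_le hp x hF₀ hF measurableSet_ball.compl hk fun s hs => ?_
    filter_upwards [hX.ae_lintegral_mul_eq hp x (tsub_pos_of_lt (hF s hs)) ht] with y hy hyD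
    rw [hy]
    refine hker y _ (add_pos ht (tsub_pos_of_lt (hF s hs))) ?_ (by simpa using hyD)
    rw [two_mul]
    gcongr
    exact tsub_le_self
  have hhigh : P x (H ∩ {ω | 2 * U < k (X t ω)}) ≤ 2⁻¹ * P x H := by
    have h2U : 2 * U * P x (H ∩ {ω | 2 * U < k (X t ω)}) ≤ U * P x H := by
      refine le_trans ?_ hint
      rw [← setLIntegral_const]
      refine (setLIntegral_mono_ae' ?_ ?_).trans (lintegral_mono_set inter_subset_left)
      · exact (hX.measurableSet_entrance F measurableSet_ball.compl).inter
          (measurableSet_lt measurable_const (hk.comp (hX.measurable t)))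
      · exact ae_of_all _ fun ω hω => hω.2.le
    rw [mul_assoc, mul_left_comm] at h2U
    have := (ENNReal.mul_le_mul_iff_right hU₀ hU).1 h2U
    calc _ = 2⁻¹ * (2 * P x (H ∩ {ω | 2 * U < k (X t ω)})) := by
          rw [← mul_assoc, ENNReal.inv_mul_cancel (by simp) (by simp), one_mul]
      _ ≤ _ := by gcongr
  set T := P x {ω | X t ω ∈ (Metric.ball x R)ᶜ} + 2 * U * μ (Metric.ball x R)
  have hsplit : P x H ≤ T + 2⁻¹ * P x H := by
    calc P x H ≤ P x (({ω | X t ω ∈ (Metric.ball x R)ᶜ} ∪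
            {ω | X t ω ∈ Metric.ball x R ∩ {y | k y ≤ 2 * U}}) ∪ (H ∩ {ω | 2 * U < k (X t ω)})) := by
          refine measure_mono fun ω hω => ?_
          by_cases h₁ : X t ω ∈ Metric.ball x R
          · by_cases h₂ : k (X t ω) ≤ 2 * U
            · exact Or.inl (Or.inr ⟨h₁, h₂⟩)
            · exact Or.inr ⟨hω, not_le.1 h₂⟩
          · exact Or.inl (Or.inl h₁)
      _ ≤ _ := (measure_union_le _ _).trans
          (add_le_add ((measure_union_le _ _).trans (add_le_add le_rfl hlow)) hhigh)
  have hhalf : P x H = 2⁻¹ * P x H + 2⁻¹ * P x H := by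
    rw [← add_mul, ENNReal.inv_two_add_inv_two, one_mul]
  -- Half of P_x(H) is absorbed on the left, which needs its finiteness.
  have hle : 2⁻¹ * P x H ≤ T := by
    refine (ENNReal.add_le_add_iff_right ?_).1 (hhalf.symm.le.trans hsplit)
    exact ENNReal.mul_ne_top (by simp) (measure_ne_top _ _)
  calc P x H = 2 * (2⁻¹ * P x H) := by
        rw [← mul_assoc, ENNReal.mul_inv_cancel (by simp) (by simp), one_mul]
    _ ≤ 2 * T := by gcongr

end Estimates

/-! ### The exit estimate -/

theorem proposition4p2 {E Ω : Type*} [MetricSpace E] [MeasurableSpace E] [BorelSpace E]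
    [MeasurableSpace Ω] (μ : Measure E) (α : ℝ) (hα₀ : 0 < α) (hα₂ : α < 2)
    (p : ℝ≥0 → E → E → ℝ) (hp : IsHeatKernel μ p)
    (P : E → Measure Ω) (X : ℝ≥0 → Ω → E) (hX : IsMarkovProcessWithKernel μ p P X)
    (V : ℝ → ℝ≥0) (hV : IsVolumeGrowth μ V) (hvol : VolumeCondition V)
    (hest : StableKernelEstimate α V p) :
    ∀ M : ℝ, 0 < M → ∃ c : ℝ, 0 < c ∧
      ∀ (x : E) (r : ℝ) (t : ℝ≥0), 1 < r → 0 < t → M * (t : ℝ) ^ (2 / α) < r →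
        P x {ω | exitTime X (Metric.ball x r) ω < (t : WithTop ℝ≥0)} ≤
          ENNReal.ofReal (c * (t : ℝ) * r ^ (-(α / 2))) := by
  intro M _
  obtain ⟨C, hC, htail⟩ := hX.exists_tail_bound hα₀ hV hvol hest
  obtain ⟨C', hC', hker⟩ := hest.exists_upper_bound hvol
  have hb : 0 < α / 2 := by positivity
  have hV₁ : (0 : ℝ) < V 1 := by exact_mod_cast hvol.pos le_rfl
  have hV₂ : (0 : ℝ) < V 2 := by exact_mod_cast hvol.pos one_le_two
  set K : ℝ := 2 * (C + 2 * (C' * 2 * (V 1 : ℝ)⁻¹) * V 2) with hK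
  have hKC : 2 * C ≤ K := by
    have : 0 < 2 * (C' * 2 * (V 1 : ℝ)⁻¹) * V 2 := by positivity
    linarith
  have hK₀ : 0 < K := by positivity
  -- The power of 3 pays for replacing r by r/3, the 2 covers t > 1/2, and K covers both maximal
  -- inequalities.
  refine ⟨(2 + K) * 3 ^ (α / 2), by positivity, fun x r t hr ht _ => ?_⟩
  have := hX.isProbabilityMeasure x
  have := hV.sigmaFinite x
  have hr₀ : 0 < r := by linarith
  have ht' : (0 : ℝ) < t := by exact_mod_cast ht
  have hscale : (r / 3) ^ (-(α / 2)) = 3 ^ (α / 2) * r ^ (-(α / 2)) := by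
    rw [Real.div_rpow hr₀.le (by norm_num), Real.rpow_neg (by norm_num : (0 : ℝ) ≤ 3), div_inv_eq_mul,
      mul_comm]
  have hgoal : (2 + K) * 3 ^ (α / 2) * t * r ^ (-(α / 2)) = (2 + K) * t * (r / 3) ^ (-(α / 2)) := by
    rw [hscale]; ring
  rw [hgoal]
  rcases lt_or_ge 3 r with hr₃ | hr₃
  · refine hX.measure_exitTime_lt_le (r' := 2 * (r / 3)) (by linarith) fun F _ hF => ?_
    refine (hX.measure_entrance_compl_ball_le hp x ht
      (e := ENNReal.ofReal (C * t * (r / 3) ^ (-(α / 2)))) (fun y s hs hst => ?_) hF).trans ?_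
    · refine (htail y (r / 3) s (by linarith) hs).trans (ENNReal.ofReal_le_ofReal ?_)
      gcongr
    · rw [← ENNReal.ofReal_ofNat 2, ← ENNReal.ofReal_mul (by norm_num)]
      refine ENNReal.ofReal_le_ofReal ?_
      rw [← mul_assoc, ← mul_assoc]
      gcongr
      linarith
  · have hpow : 1 ≤ (r / 3) ^ (-(α / 2)) :=
      Real.one_le_rpow_of_pos_of_le_one_of_nonpos (by positivity) (by linarith) (by linarith)
    suffices h : P x {ω | exitTime X (Metric.ball x r) ω < (t : WithTop ℝ≥0)} ≤
        ENNReal.ofReal ((2 + K) * t) from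
      h.trans (ENNReal.ofReal_le_ofReal (le_mul_of_one_le_right (by positivity) hpow))
    rcases lt_or_ge (1 / 2 : ℝ) t with ht₂ | ht₂
    · refine prob_le_one.trans (ENNReal.one_le_ofReal.2 ?_)
      nlinarith
    -- The midpoint of 1 and r keeps visited points at distance above 1, and s ≤ 2t ≤ 1 gives
    -- s^(2/α) ≤ 1, so the kernel bound applies.
    · refine hX.measure_exitTime_lt_le (r' := (1 + r) / 2) (by linarith) fun F hF₀ hF => ?_
      refine (hX.measure_entrance_compl_ball_le_of_kernel_le hp x (R := 2) ht
        (U := ENNReal.ofReal (C' * 2 * (V 1 : ℝ)⁻¹ * t))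
        (ENNReal.ofReal_pos.2 (by positivity)).ne' ENNReal.ofReal_ne_top
        (fun y s hs hst hy => ENNReal.ofReal_le_ofReal ?_) hF₀ hF).trans ?_
      · have hst' : (s : ℝ) ≤ 2 * t := by exact_mod_cast hst
        rw [dist_comm] at hy
        have hd : 1 < dist x y := by linarith
        have hs₁ : (s : ℝ) ^ (2 / α) ≤ 1 :=
          Real.rpow_le_one s.coe_nonneg (by linarith) (by positivity)
        have hVd : V 1 ≤ V (dist x y) := hV.mono x one_pos hd.le
        calc p s x y ≤ C' * (s * dist x y ^ (-1 - α / 2) * (V (dist x y) : ℝ)⁻¹) :=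
              hker s x y hs (by linarith) hd
          _ ≤ C' * (2 * t * 1 * (V 1 : ℝ)⁻¹) := by
              have : dist x y ^ (-1 - α / 2) ≤ 1 :=
                Real.rpow_le_one_of_one_le_of_nonpos hd.le (by linarith)
              gcongr
          _ = _ := by ring
      · have h₁ : P x {ω | X t ω ∈ (Metric.ball x 2)ᶜ} ≤ ENNReal.ofReal (C * t) := by
          refine (htail x 2 t one_lt_two ht).trans (ENNReal.ofReal_le_ofReal ?_)
          exact mul_le_of_le_one_right (by positivity)
            (Real.rpow_le_one_of_one_le_of_nonpos one_le_two (by linarith))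
        rw [hV x 2 two_pos, ← ENNReal.ofReal_coe_nnreal]
        calc _ ≤ 2 * (ENNReal.ofReal (C * t) +
              2 * ENNReal.ofReal (C' * 2 * (V 1 : ℝ)⁻¹ * t) * ENNReal.ofReal (V 2)) := by gcongr
          _ = ENNReal.ofReal (K * t) := by
              rw [← ENNReal.ofReal_ofNat 2, ← ENNReal.ofReal_mul (by norm_num),
                ← ENNReal.ofReal_mul (by positivity),
                ← ENNReal.ofReal_add (by positivity) (by positivity),
                ← ENNReal.ofReal_mul (by norm_num), hK]
              congr 1
              ring
          _ ≤ _ := by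
              refine ENNReal.ofReal_le_ofReal ?_
              gcongr
              linarith
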